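/- Consider a two-armed stochastic bandit with Bernoulli rewards of means $\mu_1,\mu_2$, where $0<\mu_2<\mu_1<1$. At each time $t\ge 1$ a policy draws an arm $A_t\in\{1,2\}$ from a probability distribution that is determined by the history $(A_1,R_1,\dots,A_{t-1},R_{t-1})$, and then observes a reward $R_t\in\{0,1\}$ which, given the history and $A_t$, is Bernoulli of mean $\mu_{A_t}$. Let $N_a(t)$ be the number of times $i<t$ with $A_i=a$, let $\hat\mu_a(t)$ be the empirical mean of the rewards received from arm $a$ before time $t$ (set to $0$ if $N_a(t)=0$), and put $\hat\mu^*(t)=\max_a\hat\mu_a(t)$. Let $\mathrm{kl}(p,q)=p\log\frac pq+(1-p)\log\frac{1-p}{1-q}\in[0,\infty]$ be the Kullback–Leibler divergence of the Bernoulli law of mean $p$ from that of mean $q$, with the usual conventions at $0$ and $1$. The policy MED samples, at every time $t$, the arm $a$ with probability proportional to $\exp\bigl(-N_a(t)\,\mathrm{kl}(\hat\mu_a(t),\hat\mu^*(t))\bigr)$, where $0\cdot\infty=0$ and $\exp(-\infty)=0$. For an integer $T\ge 1$, the sliding regret is the random variable $$\mathrm{SliReg}(T)=\limsup_{t\to\infty}\Bigl(T\mu^*-\sum_{i=1}^{T}\mu_{A_{t+i}}\Bigr),\qquad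 \mu^*=\max(\mu_1,\mu_2).$$ **Theorem.** MED has optimal sliding regret: when MED is run, for every integer $T\ge1$, almost surely $$\mathrm{SliReg}(\mathrm{MED};T)=\mu_1-\mu_2 .$$ -/

import Mathlib

open MeasureTheory Filter
open scoped ENNReal

noncomputable section

namespace Bandit

/-- A history of length `t` of a two-armed bandit with Bernoulli rewards: the successive pairs
(arm pulled, reward observed). Arm `0` and arm `1` are the two arms; the reward `true` stands for
the value one (success) and `false` for the value zero. -/
abbrev History (t : ℕ) : Type := Fin t → Fin 2 × Bool

/-- A (randomized) policy: to each history it associates the law of the next arm. -/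
abbrev Policy : Type := (t : ℕ) → History t → PMF (Fin 2)

/-- The number of visits `N_a` of arm `a` along a history. -/
def visits {t : ℕ} (h : History t) (a : Fin 2) : ℕ :=
  (Finset.univ.filter fun i : Fin t => (h i).1 = a).card

/-- The number of successes `S_a` of arm `a` along a history. -/
def successes {t : ℕ} (h : History t) (a : Fin 2) : ℕ :=
  (Finset.univ.filter fun i : Fin t => (h i).1 = a ∧ (h i).2 = true).card

/-- The empirical mean of arm `a` along a history. It is `0` if the arm has not been visited. -/
def empMean {t : ℕ} (h : History t) (a : Fin 2) : ℝ :=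
  (successes h a : ℝ) / (visits h a : ℝ)

/-- The largest empirical mean along a history. An arm that has not been visited does not
contribute, as its empirical mean is set to `0`. -/
def bestEmpMean {t : ℕ} (h : History t) : ℝ := max (empMean h 0) (empMean h 1)

/-- The Kullback–Leibler divergence of the Bernoulli law of mean `p` from the Bernoulli law of
mean `q`, for `p q ∈ [0, 1]`; it is infinite if the first law is not absolutely continuous with
respect to the second one. -/
def kl (p q : ℝ) : ℝ≥0∞ :=
  if (q = 0 ∧ p ≠ 0) ∨ (q = 1 ∧ p ≠ 1) then ⊤
  else ENNReal.ofReal (p * Real.log (p / q) + (1 - p) * Real.log ((1 - p) / (1 - q)))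

/-- The weight `exp (- N_a * kl (empirical mean of a, best empirical mean))`, with `0 * ∞ = 0` and
`exp (-∞) = 0`. -/
def medWeight {t : ℕ} (h : History t) (a : Fin 2) : ℝ≥0∞ :=
  EReal.exp (-(((visits h a : ℝ≥0∞) * kl (empMean h a) (bestEmpMean h) : ℝ≥0∞) : EReal))

theorem kl_self (p : ℝ) : kl p p = 0 := by
  have h1 : ¬((p = 0 ∧ p ≠ 0) ∨ (p = 1 ∧ p ≠ 1)) := by tauto
  have hd : ∀ x : ℝ, Real.log (x / x) = 0 := fun x => by
    by_cases hx : x = 0 <;> simp [hx]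
  rw [kl, if_neg h1, hd, hd]
  simp

theorem medWeight_le_one {t : ℕ} (h : History t) (a : Fin 2) : medWeight h a ≤ 1 := by
  rw [medWeight, ← EReal.exp_zero]
  apply EReal.exp_monotone
  rw [← neg_zero, EReal.neg_le_neg_iff]
  exact EReal.coe_ennreal_nonneg _

theorem medWeight_tsum_ne_zero {t : ℕ} (h : History t) : ∑' a, medWeight h a ≠ 0 := by
  have key : ∃ a, empMean h a = bestEmpMean h := by
    rcases le_total (empMean h 0) (empMean h 1) with hle | hle
    · exact ⟨1, (max_eq_right hle).symm⟩
    · exact ⟨0, (max_eq_left hle).symm⟩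
  obtain ⟨a, ha⟩ := key
  have h1 : medWeight h a = 1 := by simp [medWeight, ha, kl_self]
  intro h0
  rw [ENNReal.tsum_eq_zero] at h0
  exact one_ne_zero (h1.symm.trans (h0 a))

theorem medWeight_tsum_ne_top {t : ℕ} (h : History t) : ∑' a, medWeight h a ≠ ⊤ := by
  rw [tsum_fintype]
  exact ENNReal.sum_ne_top.2 fun a _ => ((medWeight_le_one h a).trans_lt ENNReal.one_lt_top).ne

/-- The MED policy: arm `a` is sampled with probability proportional to
`exp (- N_a * kl (empirical mean of a, best empirical mean))`. -/
def med : Policy := fun _ h =>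
  PMF.normalize (medWeight h) (medWeight_tsum_ne_zero h) (medWeight_tsum_ne_top h)

/-- The probability that a Bernoulli variable of mean `p` takes the value `r`. -/
def bernoulliMass (p : ℝ) (r : Bool) : ℝ≥0∞ := ENNReal.ofReal (if r then p else 1 - p)

/-- The history before round `t`. Rounds are numbered from `0`, so that `A t` and `R t` are the
arm and the reward of the round with number `t + 1` if one starts to count from one. -/
def history {Ω : Type*} (A : ℕ → Ω → Fin 2) (R : ℕ → Ω → Bool) (t : ℕ) (ω : Ω) : History t :=
  fun i => (A i ω, R i ω)

/-- `A` and `R` are the arms pulled and the rewards observed during a run of the policy `π` on the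
two-armed Bernoulli bandit of means `μ`: given the past history `h`, the next arm is drawn from
`π t h`, and given the history and the arm `a`, the reward is Bernoulli of mean `μ a`. -/
structure IsRun {Ω : Type*} [MeasurableSpace Ω] (P : Measure Ω) (μ : Fin 2 → ℝ) (π : Policy)
    (A : ℕ → Ω → Fin 2) (R : ℕ → Ω → Bool) : Prop where
  measurable_arm : ∀ t, Measurable (A t)
  measurable_reward : ∀ t, Measurable (R t)
  law : ∀ (t : ℕ) (h : History t) (a : Fin 2) (r : Bool),
    P {ω | history A R t ω = h ∧ A t ω = a ∧ R t ω = r} =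
      P {ω | history A R t ω = h} * π t h a * bernoulliMass (μ a) r

/-- The sliding regret over windows of length `T`, a random variable:
`limsup_{t → ∞} (T μ^* - ∑_{i = 1}^T μ_{A_{t+i}})`, where `μ^*` is the largest mean. (As rounds are
numbered from `0`, the window that starts after `t` rounds is `t, …, t + T - 1`.) -/
def slidingRegret {Ω : Type*} (μ : Fin 2 → ℝ) (A : ℕ → Ω → Fin 2) (T : ℕ) (ω : Ω) : ℝ :=
  limsup (fun t : ℕ => (T : ℝ) * max (μ 0) (μ 1) - ∑ i ∈ Finset.range T, μ (A (t + i) ω)) atTop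

end Bandit

end

open Topology

noncomputable section

namespace Bandit

section Run

variable {Ω : Type*} [mΩ : MeasurableSpace Ω] {P : Measure Ω} {μ : Fin 2 → ℝ} {π : Policy}
  {A : ℕ → Ω → Fin 2} {R : ℕ → Ω → Bool}

/-! A pull of the worse arm makes the next one geometrically less likely, so such pulls recur
forever but end up isolated.

If an arm were pulled finitely often, the mean of the other one would converge inside `(0, 1)`
(`IsRun.ae_tendsto_empMean`). Then `kl` stays bounded, the sampling probabilities of the neglected
arm are bounded below, and conditional Borel–Cantelli (`IsRun.frequently_pull_iff`) contradicts its
neglect.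

So both empirical means converge; eventually the better arm leads, and the worse arm `b` is sampled
with probability at most `exp (-c * N_b)`. Fix a lag `j`. Over the rounds at which `b` was pulled
`j` rounds before, these probabilities are dominated by a geometric series, since each such pull
increases `N_b`. Hence two pulls of `b` at distance `j` happen finitely often
(`ae_eventually_not_pull_twice`). Late windows of length `T` then contain at most one pull of `b`,
and infinitely many contain one, which gives the limsup. -/

/-! ### Conditional expectations given the history. -/

theorem IsRun.measurable_history (hrun : IsRun P μ π A R) (t : ℕ) :
    Measurable (history A R t) :=
  measurable_pi_lambda _ fun i => (hrun.measurable_arm i).prodMk (hrun.measurable_reward i)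

/-- The filtration generated by the arms and the rewards; `ℱ t` is the past of round `t`. -/
def IsRun.filtration (hrun : IsRun P μ π A R) : Filtration ℕ mΩ where
  seq t := MeasurableSpace.comap (history A R t) inferInstance
  mono' s t hst := by
    have : history A R s = (fun (h : History t) (i : Fin s) => h (i.castLE hst)) ∘
        history A R t := rfl
    change MeasurableSpace.comap (history A R s) _ ≤ _
    rw [this, ← MeasurableSpace.comap_comp]
    exact MeasurableSpace.comap_mono Measurable.of_discrete.comap_le
  le' t := (hrun.measurable_history t).comap_le

/-- The expectation of `f` over the next arm and reward, given the history. -/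
def stepMean (μ : Fin 2 → ℝ) (π : Policy) {t : ℕ} (f : History t → Fin 2 → Bool → ℝ)
    (h : History t) : ℝ :=
  ∑ a, ∑ r, (π t h a).toReal * (bernoulliMass (μ a) r).toReal * f h a r

theorem IsRun.integral_history [IsProbabilityMeasure P] (hrun : IsRun P μ π A R) {t : ℕ}
    (g : History t → ℝ) :
    ∫ ω, g (history A R t ω) ∂P = ∑ h, P.real {ω | history A R t ω = h} * g h := by
  have := Measure.isProbabilityMeasure_map (μ := P) (hrun.measurable_history t).aemeasurable
  rw [← integral_map (φ := history A R t) (hrun.measurable_history t).aemeasurable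
    Measurable.of_discrete.aestronglyMeasurable, integral_fintype Integrable.of_finite]
  refine Finset.sum_congr rfl fun h _ => ?_
  rw [map_measureReal_apply (hrun.measurable_history t) (measurableSet_singleton h)]
  rfl

theorem IsRun.measurable_step (hrun : IsRun P μ π A R) (t : ℕ) :
    Measurable fun ω => (history A R t ω, A t ω, R t ω) :=
  (hrun.measurable_history t).prodMk ((hrun.measurable_arm t).prodMk (hrun.measurable_reward t))

/-- Histories of a fixed length form a finite type, so the integral is a finite sum, whose terms
`law` factors. -/
theorem IsRun.integral_step [IsProbabilityMeasure P] (hrun : IsRun P μ π A R) {t : ℕ}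
    (f : History t → Fin 2 → Bool → ℝ) :
    ∫ ω, f (history A R t ω) (A t ω) (R t ω) ∂P =
      ∫ ω, stepMean μ π f (history A R t ω) ∂P := by
  have hX := hrun.measurable_step t
  have := Measure.isProbabilityMeasure_map (μ := P) hX.aemeasurable
  rw [hrun.integral_history]
  have h1 := integral_map (μ := P) hX.aemeasurable
    (f := fun x : History t × Fin 2 × Bool => f x.1 x.2.1 x.2.2)
    Measurable.of_discrete.aestronglyMeasurable
  rw [← h1, integral_fintype Integrable.of_finite, Fintype.sum_prod_type]
  refine Finset.sum_congr rfl fun h _ => ?_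
  rw [Fintype.sum_prod_type, stepMean, Finset.mul_sum]
  refine Finset.sum_congr rfl fun a _ => ?_
  rw [Finset.mul_sum]
  refine Finset.sum_congr rfl fun r _ => ?_
  rw [map_measureReal_apply hX (measurableSet_singleton _)]
  have h2 : (fun ω => (history A R t ω, A t ω, R t ω)) ⁻¹' {(h, a, r)} =
      {ω | history A R t ω = h ∧ A t ω = a ∧ R t ω = r} := by
    ext ω; simp
  rw [h2, measureReal_def, hrun.law, ENNReal.toReal_mul, ENNReal.toReal_mul, measureReal_def]
  simp only [smul_eq_mul]
  ring

theorem IsRun.integrable_step [IsProbabilityMeasure P] (hrun : IsRun P μ π A R) {t : ℕ}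
    (f : History t → Fin 2 → Bool → ℝ) :
    Integrable (fun ω => f (history A R t ω) (A t ω) (R t ω)) P := by
  have hX := hrun.measurable_step t
  have := Measure.isProbabilityMeasure_map (μ := P) hX.aemeasurable
  have h1 : Integrable (fun x : History t × Fin 2 × Bool => f x.1 x.2.1 x.2.2)
      (P.map fun ω => (history A R t ω, A t ω, R t ω)) := Integrable.of_finite
  exact h1.comp_measurable hX

theorem IsRun.condExp_step [IsProbabilityMeasure P] (hrun : IsRun P μ π A R) {t : ℕ}
    (f : History t → Fin 2 → Bool → ℝ) :
    P[fun ω => f (history A R t ω) (A t ω) (R t ω) | hrun.filtration t] =ᵐ[P]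
      fun ω => stepMean μ π f (history A R t ω) := by
  have hg : Integrable (fun ω => stepMean μ π f (history A R t ω)) P :=
    hrun.integrable_step (fun h _ _ => stepMean μ π f h)
  refine (ae_eq_condExp_of_forall_setIntegral_eq (hrun.filtration.le t) (hrun.integrable_step f)
    (fun _ _ _ => hg.integrableOn) ?_ ?_).symm
  · rintro _ ⟨s, -, rfl⟩ -
    classical
    have hs : MeasurableSet (history A R t ⁻¹' s) :=
      hrun.measurable_history t s.toFinite.measurableSet
    rw [← integral_indicator hs, ← integral_indicator hs]
    have h1 := hrun.integral_step (fun h a r => s.indicator (fun h => f h a r) h)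
    have h2 : stepMean μ π (fun h a r => s.indicator (fun h => f h a r) h) =
        s.indicator (stepMean μ π f) := by
      ext h
      by_cases hh : h ∈ s <;> simp [stepMean, hh]
    rw [h2] at h1
    exact h1.symm
  · refine StronglyMeasurable.aestronglyMeasurable (Measurable.stronglyMeasurable ?_)
    exact (Measurable.of_discrete (f := stepMean μ π f)).comp
      (comap_measurable (history A R t))

theorem IsRun.measurable_comp_history (hrun : IsRun P μ π A R) {t : ℕ} {α : Type*}
    [MeasurableSpace α] (g : History t → α) :
    Measurable[hrun.filtration t] fun ω => g (history A R t ω) :=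
  (Measurable.of_discrete (f := g)).comp (comap_measurable (history A R t))

theorem toReal_bernoulliMass {p : ℝ} (h0 : 0 ≤ p) (h1 : p ≤ 1) :
    (bernoulliMass p true).toReal = p ∧ (bernoulliMass p false).toReal = 1 - p := by
  simp [bernoulliMass, h0, h1]

/-! ### Conditional Borel–Cantelli. -/

/-- Lévy's form of the Borel–Cantelli lemmas for the pulls of an arm along a predictable set of
rounds. -/
theorem IsRun.frequently_pull_iff [IsProbabilityMeasure P] (hrun : IsRun P μ π A R)
    (hμ : ∀ a, 0 ≤ μ a ∧ μ a ≤ 1) (a : Fin 2) (Q : (t : ℕ) → Set (History t)) :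
    ∀ᵐ ω ∂P, (∃ᶠ t in atTop, A t ω = a ∧ history A R t ω ∈ Q t) ↔
      Tendsto (fun n => ∑ t ∈ Finset.range n,
        (Q t).indicator (fun h => (π t h a).toReal) (history A R t ω)) atTop atTop := by
  classical
  -- Shifted by one: what happens in round `t` is known only at time `t + 1`.
  let s : ℕ → Set Ω := fun n => Nat.casesOn n ∅ fun t => {ω | A t ω = a ∧ history A R t ω ∈ Q t}
  have hs : ∀ n, MeasurableSet[hrun.filtration n] (s n) := by
    intro n
    cases n with
    | zero => exact @MeasurableSet.empty _ (hrun.filtration 0)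
    | succ t =>
      have h1 : s (t + 1) = history A R (t + 1) ⁻¹' {h | (h (Fin.last t)).1 = a ∧
          (fun i : Fin t => h i.castSucc) ∈ Q t} := rfl
      rw [h1]
      exact ⟨_, Set.Finite.measurableSet (Set.toFinite _), rfl⟩
  have hc : ∀ᵐ ω ∂P, ∀ t, (P[(s (t + 1)).indicator (1 : Ω → ℝ) | hrun.filtration t]) ω =
      (Q t).indicator (fun h => (π t h a).toReal) (history A R t ω) := by
    rw [ae_all_iff]
    intro t
    have h1 := hrun.condExp_step (t := t) (fun h b _ => if b = a ∧ h ∈ Q t then 1 else 0)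
    have h2 : (s (t + 1)).indicator (1 : Ω → ℝ) =
        fun ω => if A t ω = a ∧ history A R t ω ∈ Q t then 1 else 0 := by
      ext ω
      simp [s, Set.indicator_apply]
    rw [h2]
    filter_upwards [h1] with ω hω
    rw [hω, stepMean]
    have h3 : ∀ b, (bernoulliMass (μ b) true).toReal + (bernoulliMass (μ b) false).toReal = 1 := by
      intro b
      rw [(toReal_bernoulliMass (hμ b).1 (hμ b).2).1, (toReal_bernoulliMass (hμ b).1 (hμ b).2).2]
      ring
    by_cases hQ : history A R t ω ∈ Q t
    · simp [hQ, ← mul_add, h3]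
    · simp [hQ]
  filter_upwards [ae_mem_limsup_atTop_iff P hs, hc] with ω h1 h2
  simp only [h2] at h1
  rw [← h1, mem_limsup_iff_frequently_mem]
  conv_rhs => rw [← map_add_atTop_eq_nat 1, frequently_map]
  rfl

/-! ### Counts of pulls and successes. -/

theorem visits_history_succ {Ω : Type*} (A : ℕ → Ω → Fin 2) (R : ℕ → Ω → Bool) (t : ℕ) (ω : Ω)
    (a : Fin 2) :
    visits (history A R (t + 1) ω) a =
      visits (history A R t ω) a + if A t ω = a then 1 else 0 := by
  simp only [visits, Finset.card_filter]
  rw [Fin.sum_univ_castSucc]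
  rfl

theorem successes_history_succ {Ω : Type*} (A : ℕ → Ω → Fin 2) (R : ℕ → Ω → Bool) (t : ℕ) (ω : Ω)
    (a : Fin 2) :
    successes (history A R (t + 1) ω) a =
      successes (history A R t ω) a + if A t ω = a ∧ R t ω = true then 1 else 0 := by
  simp only [successes, Finset.card_filter]
  rw [Fin.sum_univ_castSucc]
  rfl

theorem visits_history_mono {Ω : Type*} (A : ℕ → Ω → Fin 2) (R : ℕ → Ω → Bool) (ω : Ω)
    (a : Fin 2) :
    Monotone fun t => visits (history A R t ω) a :=
  monotone_nat_of_le_succ fun t => by rw [visits_history_succ]; omega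

theorem successes_le_visits {t : ℕ} (h : History t) (a : Fin 2) : successes h a ≤ visits h a :=
  Finset.card_le_card fun i hi => by
    simp only [Finset.mem_filter] at hi ⊢
    exact ⟨hi.1, hi.2.1⟩

theorem empMean_nonneg {t : ℕ} (h : History t) (a : Fin 2) : 0 ≤ empMean h a := by
  unfold empMean; positivity

theorem empMean_le_one {t : ℕ} (h : History t) (a : Fin 2) : empMean h a ≤ 1 :=
  div_le_one_of_le₀ (by exact_mod_cast successes_le_visits h a) (by positivity)

theorem tendsto_visits_of_frequently {Ω : Type*} {A : ℕ → Ω → Fin 2} {R : ℕ → Ω → Bool} {ω : Ω}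
    {a : Fin 2} (h : ∃ᶠ t in atTop, A t ω = a) :
    Tendsto (fun t => visits (history A R t ω) a) atTop atTop := by
  refine tendsto_atTop_atTop_of_monotone (visits_history_mono A R ω a) fun b => ?_
  induction b with
  | zero => exact ⟨0, Nat.zero_le _⟩
  | succ b ih =>
    obtain ⟨t, ht⟩ := ih
    obtain ⟨s, hs, hA⟩ := frequently_atTop.1 h t
    refine ⟨s + 1, ?_⟩
    have := visits_history_mono A R ω a hs
    rw [visits_history_succ, if_pos hA]
    simp only at this
    omega

/-! ### Law of large numbers by exponential martingales. -/

/-- The exponential martingale of the rewards of arm `a`. -/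
def expMartingale (p l : ℝ) (a : Fin 2) {t : ℕ} (h : History t) : ℝ :=
  Real.exp (l * successes h a - Real.log (1 - p + p * Real.exp l) * visits h a)

theorem one_sub_add_mul_exp_pos {p : ℝ} (h0 : 0 < p) (h1 : p < 1) (l : ℝ) :
    0 < 1 - p + p * Real.exp l := by
  have := mul_pos h0 (Real.exp_pos l)
  linarith

theorem IsRun.martingale_expMartingale [IsProbabilityMeasure P] (hrun : IsRun P μ π A R)
    (hμ : ∀ a, 0 < μ a ∧ μ a < 1) (l : ℝ) (a : Fin 2) :
    Martingale (fun t ω => expMartingale (μ a) l a (history A R t ω)) hrun.filtration P := by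
  refine martingale_nat
    (fun t => (hrun.measurable_comp_history (expMartingale (μ a) l a)).stronglyMeasurable)
    (fun t => hrun.integrable_step fun h _ _ => expMartingale (μ a) l a h) fun t => ?_
  set c := Real.log (1 - μ a + μ a * Real.exp l) with hc
  have hpos := one_sub_add_mul_exp_pos (hμ a).1 (hμ a).2 l
  have hexp : Real.exp c = 1 - μ a + μ a * Real.exp l := Real.exp_log hpos
  -- The second factor is the multiplicative increment; its mean over the reward is `1` for either
  -- arm.
  let f : History t → Fin 2 → Bool → ℝ := fun h b r => expMartingale (μ a) l a h *
    if b = a then (if r = true then Real.exp (l - c) else Real.exp (-c)) else 1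
  have h1 : (fun ω => expMartingale (μ a) l a (history A R (t + 1) ω)) =
      fun ω => f (history A R t ω) (A t ω) (R t ω) := by
    ext ω
    simp only [f, expMartingale, visits_history_succ, successes_history_succ, ← hc]
    by_cases hA : A t ω = a
    · by_cases hR : R t ω = true
      · simp only [hA, hR, and_self, if_true]
        rw [← Real.exp_add]; congr 1; push_cast; ring
      · simp only [hA, hR, Bool.false_eq_true, and_false, if_true, if_false]
        rw [← Real.exp_add]; congr 1; push_cast; ring
    · simp [hA]
  have h2 : stepMean μ π f = expMartingale (μ a) l a := by
    ext h
    have hB := fun b => toReal_bernoulliMass (hμ b).1.le (hμ b).2.le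
    have h3 : ∀ b, ∑ r, (bernoulliMass (μ b) r).toReal *
        (if b = a then (if r = true then Real.exp (l - c) else Real.exp (-c)) else 1) = 1 := by
      intro b
      rw [Fintype.sum_bool, (hB b).1, (hB b).2]
      by_cases hb : b = a
      · subst hb
        simp only [if_true, Bool.false_eq_true, if_false]
        rw [sub_eq_add_neg, Real.exp_add, Real.exp_neg, hexp]
        field_simp
        ring
      · simp [hb]
    have h4 : ∑ b, (π t h b).toReal = 1 := by
      have := (π t h).tsum_coe
      rw [tsum_fintype] at this
      rw [← ENNReal.toReal_sum fun b _ => (π t h).apply_ne_top b, this, ENNReal.toReal_one]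
    calc stepMean μ π f h = ∑ b, (π t h b).toReal * expMartingale (μ a) l a h *
          ∑ r, (bernoulliMass (μ b) r).toReal *
          (if b = a then (if r = true then Real.exp (l - c) else Real.exp (-c)) else 1) := by
          simp only [stepMean, f, Finset.mul_sum]
          exact Finset.sum_congr rfl fun b _ => Finset.sum_congr rfl fun r _ => by ring
      _ = expMartingale (μ a) l a h := by
          simp only [h3, mul_one]
          rw [← Finset.sum_mul, h4, one_mul]
  rw [h1]
  filter_upwards [hrun.condExp_step f] with ω hω
  rw [hω, h2]

/-- A nonnegative martingale started at `1` is bounded in `L¹`, hence converges almost surely and is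
bounded along each path; the exponent lies below its exponential. -/
theorem IsRun.ae_expMartingale_bdd [IsProbabilityMeasure P] (hrun : IsRun P μ π A R)
    (hμ : ∀ a, 0 < μ a ∧ μ a < 1) (l : ℝ) (a : Fin 2) :
    ∀ᵐ ω ∂P, ∃ C : ℝ, ∀ t, l * successes (history A R t ω) a -
      Real.log (1 - μ a + μ a * Real.exp l) * visits (history A R t ω) a ≤ C := by
  have hM := hrun.martingale_expMartingale hμ l a
  have hb : ∀ t, eLpNorm (fun ω => expMartingale (μ a) l a (history A R t ω)) 1 P ≤
      (1 : NNReal) := by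
    intro t
    have hnn : ∀ s ω, 0 ≤ expMartingale (μ a) l a (history A R s ω) :=
      fun _ _ => (Real.exp_pos _).le
    have h1 := hM.setIntegral_eq (Nat.zero_le t) MeasurableSet.univ
    have h0 : ∀ ω, expMartingale (μ a) l a (history A R 0 ω) = 1 := by
      intro ω
      simp [expMartingale, visits, successes]
    simp only [setIntegral_univ, h0, integral_const, smul_eq_mul, mul_one] at h1
    rw [eLpNorm_one_eq_lintegral_enorm]
    have h2 : ∀ ω, ‖expMartingale (μ a) l a (history A R t ω)‖ₑ =
        ENNReal.ofReal (expMartingale (μ a) l a (history A R t ω)) :=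
      fun ω => Real.enorm_of_nonneg (hnn t ω)
    simp only [h2]
    rw [← ofReal_integral_eq_lintegral_ofReal (hM.integrable t) (ae_of_all _ (hnn t)), ← h1]
    simp
  filter_upwards [hM.submartingale.exists_ae_tendsto_of_bdd hb] with ω ⟨c, hc⟩
  obtain ⟨C, hC⟩ := hc.bddAbove_range
  refine ⟨C, fun t => ?_⟩
  have h1 : expMartingale (μ a) l a (history A R t ω) ≤ C := hC ⟨t, rfl⟩
  have h2 := Real.add_one_le_exp (l * successes (history A R t ω) a -
      Real.log (1 - μ a + μ a * Real.exp l) * visits (history A R t ω) a)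
  simp only [expMartingale] at h1
  linarith

theorem log_one_sub_add_mul_exp_le {p l : ℝ} (h0 : 0 < p) (h1 : p < 1) (hl : |l| ≤ 1) :
    Real.log (1 - p + p * Real.exp l) ≤ p * l + l ^ 2 := by
  have h2 := Real.log_le_sub_one_of_pos (one_sub_add_mul_exp_pos h0 h1 l)
  have h3 := (abs_le.1 (Real.abs_exp_sub_one_sub_id_le hl)).2
  nlinarith [mul_le_mul_of_nonneg_left h3 h0.le, mul_le_mul_of_nonneg_right h1.le (sq_nonneg l)]

/-- The law of large numbers for the rewards of an arm that is pulled infinitely often. -/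
theorem IsRun.ae_tendsto_empMean [IsProbabilityMeasure P] (hrun : IsRun P μ π A R)
    (hμ : ∀ a, 0 < μ a ∧ μ a < 1) (a : Fin 2) :
    ∀ᵐ ω ∂P, (∃ᶠ t in atTop, A t ω = a) →
      Tendsto (fun t => empMean (history A R t ω) a) atTop (𝓝 (μ a)) := by
  -- Countably many slopes tending to `0`, of both signs, so that one null set serves every `ε`.
  have h1 : ∀ᵐ ω ∂P, ∀ k : ℕ, _ := ae_all_iff.2 fun k : ℕ =>
    hrun.ae_expMartingale_bdd hμ (1 / ((k : ℝ) + 1)) a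
  have h2 : ∀ᵐ ω ∂P, ∀ k : ℕ, _ := ae_all_iff.2 fun k : ℕ =>
    hrun.ae_expMartingale_bdd hμ (-(1 / ((k : ℝ) + 1))) a
  filter_upwards [h1, h2] with ω h1 h2 hfreq
  have hN := tendsto_natCast_atTop_atTop (R := ℝ).comp
    (tendsto_visits_of_frequently (R := R) hfreq)
  rw [Metric.tendsto_atTop]
  intro ε hε
  obtain ⟨k, hk⟩ := exists_nat_one_div_lt (half_pos hε)
  obtain ⟨C1, hC1⟩ := h1 k
  obtain ⟨C2, hC2⟩ := h2 k
  set l : ℝ := 1 / ((k : ℝ) + 1) with hl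
  have hl0 : 0 < l := by positivity
  have hl1 : l ≤ 1 := by
    rw [hl, div_le_one (by positivity)]
    linarith [Nat.cast_nonneg (α := ℝ) k]
  have hb1 := log_one_sub_add_mul_exp_le (hμ a).1 (hμ a).2 (l := l) (by rwa [abs_of_pos hl0])
  have hb2 := log_one_sub_add_mul_exp_le (hμ a).1 (hμ a).2 (l := -l)
    (by rwa [abs_neg, abs_of_pos hl0])
  -- Beyond `t₀` each constant is below `l * (ε / 2) * N`; as `l < ε / 2`, so is the quadratic error
  -- `l ^ 2 * N`.
  obtain ⟨t₀, ht₀⟩ := eventually_atTop.1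
    (hN.eventually_gt_atTop (max 0 (max (C1 / (l * (ε / 2))) (C2 / (l * (ε / 2))))))
  refine ⟨t₀, fun t ht => ?_⟩
  have h3 := ht₀ t ht
  simp only [Function.comp_apply, max_lt_iff] at h3
  obtain ⟨hNpos, hNC1, hNC2⟩ := h3
  specialize hC1 t
  specialize hC2 t
  rw [div_lt_iff₀ (by positivity)] at hNC1 hNC2
  set N : ℝ := (visits (history A R t ω) a : ℝ)
  set S : ℝ := (successes (history A R t ω) a : ℝ)
  have e1 : l * S ≤ (μ a * l + l ^ 2) * N + C1 := by
    nlinarith [mul_le_mul_of_nonneg_right hb1 hNpos.le]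
  have e2 : -l * S ≤ (μ a * -l + (-l) ^ 2) * N + C2 := by
    nlinarith [mul_le_mul_of_nonneg_right hb2 hNpos.le]
  have hlε : l * l * N < l * (ε / 2) * N := by
    gcongr
  have f1 : S < (μ a + ε) * N := by
    refine lt_of_mul_lt_mul_left ?_ hl0.le
    nlinarith
  have f2 : (μ a - ε) * N < S := by
    refine lt_of_mul_lt_mul_left ?_ hl0.le
    nlinarith
  rw [Real.dist_eq, empMean, abs_lt]
  constructor
  · rw [lt_sub_iff_add_lt, lt_div_iff₀ hNpos]
    linarith
  · rw [sub_lt_iff_lt_add, div_lt_iff₀ hNpos]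
    linarith

/-! ### Bounds on the MED weights and on the divergence. -/

theorem bestEmpMean_eq_max {t : ℕ} (h : History t) {a b : Fin 2} (hab : a ≠ b) :
    bestEmpMean h = max (empMean h a) (empMean h b) := by
  fin_cases a <;> fin_cases b <;> simp_all [bestEmpMean, max_comm]

theorem medWeight_eq_one {t : ℕ} {h : History t} {a : Fin 2} (ha : empMean h a = bestEmpMean h) :
    medWeight h a = 1 := by
  simp [medWeight, ha, kl_self]

theorem medWeight_le {t : ℕ} {h : History t} {a : Fin 2} {c : ℝ} (hc0 : 0 ≤ c)
    (hc : ENNReal.ofReal c ≤ kl (empMean h a) (bestEmpMean h)) :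
    medWeight h a ≤ ENNReal.ofReal (Real.exp (-(visits h a * c))) := by
  rw [medWeight, ← EReal.exp_coe]
  refine EReal.exp_monotone ?_
  rw [EReal.coe_neg, EReal.neg_le_neg_iff, ← max_eq_left (by positivity : 0 ≤ visits h a * c),
    ← EReal.coe_ennreal_ofReal, EReal.coe_ennreal_le_coe_ennreal_iff,
    ENNReal.ofReal_mul (by positivity), ENNReal.ofReal_natCast]
  gcongr

theorem le_medWeight {t : ℕ} {h : History t} {a : Fin 2} {c : ℝ} (hc0 : 0 ≤ c)
    (hc : kl (empMean h a) (bestEmpMean h) ≤ ENNReal.ofReal c) :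
    ENNReal.ofReal (Real.exp (-(visits h a * c))) ≤ medWeight h a := by
  rw [medWeight, ← EReal.exp_coe]
  refine EReal.exp_monotone ?_
  rw [EReal.coe_neg, EReal.neg_le_neg_iff, ← max_eq_left (by positivity : 0 ≤ visits h a * c),
    ← EReal.coe_ennreal_ofReal, EReal.coe_ennreal_le_coe_ennreal_iff,
    ENNReal.ofReal_mul (by positivity), ENNReal.ofReal_natCast]
  gcongr

/-- The normalizing sum is at least `1`. -/
theorem med_apply_le {t : ℕ} {h : History t} {a b : Fin 2} (hb : medWeight h b = 1) :
    med t h a ≤ medWeight h a := by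
  rw [med, PMF.normalize_apply]
  refine mul_le_of_le_one_right' (ENNReal.inv_le_one.2 ?_)
  rw [← hb]
  exact ENNReal.le_tsum b

theorem medWeight_div_two_le {t : ℕ} (h : History t) (a : Fin 2) :
    medWeight h a * 2⁻¹ ≤ med t h a := by
  rw [med, PMF.normalize_apply]
  gcongr
  rw [tsum_fintype, Fin.sum_univ_two]
  exact (add_le_add (medWeight_le_one h 0) (medWeight_le_one h 1)).trans one_add_one_eq_two.le

theorem kl_eq_ofReal (p : ℝ) {q : ℝ} (h0 : 0 < q) (h1 : q < 1) :
    kl p q = ENNReal.ofReal (p * Real.log (p / q) + (1 - p) * Real.log ((1 - p) / (1 - q))) :=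
  if_neg (by rintro (⟨h, -⟩ | ⟨h, -⟩) <;> linarith)

theorem mul_log_div_le {p q : ℝ} (hp0 : 0 ≤ p) (hp1 : p ≤ 1) (hq0 : 0 < q) (hq1 : q ≤ 1) :
    p * Real.log (p / q) ≤ -Real.log q := by
  have hq := Real.log_nonpos hq0.le hq1
  rcases hp0.eq_or_lt with rfl | hp
  · simpa using hq
  · rw [Real.log_div hp.ne' hq0.ne']
    nlinarith [Real.log_nonpos hp0 hp1]

theorem kl_le {p q d : ℝ} (hp0 : 0 ≤ p) (hp1 : p ≤ 1) (hd : 0 < d) (hq0 : d ≤ q)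
    (hq1 : q ≤ 1 - d) : kl p q ≤ ENNReal.ofReal (-2 * Real.log d) := by
  rw [kl_eq_ofReal p (hd.trans_le hq0) (by linarith)]
  refine ENNReal.ofReal_le_ofReal ?_
  have h1 := mul_log_div_le hp0 hp1 (hd.trans_le hq0) (by linarith)
  have h2 := mul_log_div_le (p := 1 - p) (q := 1 - q) (by linarith) (by linarith) (by linarith)
    (by linarith)
  have h3 := Real.log_le_log hd hq0
  have h4 := Real.log_le_log hd (by linarith : d ≤ 1 - q)
  linarith

/-- This is `log x < x - 1` at `x = q / p`. Added over the two outcomes, it gives strict positivity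
of the divergence. -/
theorem sub_lt_mul_log_div {p q : ℝ} (hp : 0 < p) (hq : 0 < q) (hpq : p ≠ q) :
    p - q < p * Real.log (p / q) := by
  have h1 := Real.log_lt_sub_one_of_pos (div_pos hq hp)
    (by rw [Ne, div_eq_one_iff_eq hp.ne']; exact hpq.symm)
  rw [← inv_div, Real.log_inv]
  have h2 := mul_lt_mul_of_pos_left h1 hp
  have h3 : p * (q / p - 1) = q - p := by field_simp
  linarith

theorem exists_pos_eventually_le_kl {ι : Type*} {l : Filter ι} {f g : ι → ℝ} {p q : ℝ}
    (hp0 : 0 < p) (hp1 : p < 1) (hq0 : 0 < q) (hq1 : q < 1) (hpq : p ≠ q)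
    (hf : Tendsto f l (𝓝 p)) (hg : Tendsto g l (𝓝 q)) :
    ∃ c : ℝ, 0 < c ∧ ∀ᶠ i in l, ENNReal.ofReal c ≤ kl (f i) (g i) := by
  have hpos : 0 < p * Real.log (p / q) + (1 - p) * Real.log ((1 - p) / (1 - q)) := by
    have h1 := sub_lt_mul_log_div hp0 hq0 hpq
    have h2 := sub_lt_mul_log_div (sub_pos.2 hp1) (sub_pos.2 hq1) (by simpa using hpq)
    linarith
  have hlim : Tendsto (fun i => f i * Real.log (f i / g i) +
      (1 - f i) * Real.log ((1 - f i) / (1 - g i))) l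
      (𝓝 (p * Real.log (p / q) + (1 - p) * Real.log ((1 - p) / (1 - q)))) := by
    have hf' := hf.const_sub 1
    have hg' := hg.const_sub 1
    exact (hf.mul ((hf.div hg hq0.ne').log (div_pos hp0 hq0).ne')).add
      (hf'.mul ((hf'.div hg' (sub_pos.2 hq1).ne').log
        (div_pos (sub_pos.2 hp1) (sub_pos.2 hq1)).ne'))
  refine ⟨_, half_pos hpos, ?_⟩
  filter_upwards [hlim.eventually_const_lt (half_lt_self hpos), hg.eventually_const_lt hq0,
    hg.eventually_lt_const hq1] with i h1 h2 h3
  rw [kl_eq_ofReal _ h2 h3]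
  exact ENNReal.ofReal_le_ofReal h1.le

/-! ### Both arms are pulled infinitely often. -/

/-- If an arm is visited finitely often and the empirical mean of the other one has a limit in
`(0, 1)`, then MED samples the former with a probability that is bounded below. -/
theorem exists_pos_eventually_le_med {Ω : Type*} {A : ℕ → Ω → Fin 2} {R : ℕ → Ω → Bool} {ω : Ω}
    {a b : Fin 2} (hab : a ≠ b) {m : ℝ} (hm0 : 0 < m) (hm1 : m < 1)
    (hb : Tendsto (fun t => empMean (history A R t ω) b) atTop (𝓝 m)) {N : ℕ}
    (ha : ∀ t, visits (history A R t ω) a ≤ N) :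
    ∃ ε : ℝ, 0 < ε ∧ ∀ᶠ t in atTop, ε ≤ (med t (history A R t ω) a).toReal := by
  obtain ⟨d, hd0, hdm, hd1⟩ : ∃ d : ℝ, 0 < d ∧ d < m ∧ m < 1 - d := by
    refine ⟨min m (1 - m) / 2, ?_, ?_, ?_⟩
    · have := lt_min hm0 (sub_pos.2 hm1)
      positivity
    · linarith [min_le_left m (1 - m)]
    · linarith [min_le_right m (1 - m)]
  set K := -2 * Real.log d
  have hK : 0 ≤ K := by
    have := Real.log_nonpos hd0.le (by linarith)
    simp only [K]
    linarith
  -- The weight is at least `exp (-(N * K))` and the normalizing sum at most `2`.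
  refine ⟨Real.exp (-(N * K)) * 2⁻¹, by positivity, ?_⟩
  filter_upwards [hb.eventually_const_lt hdm, hb.eventually_lt_const hd1] with t h1 h2
  set h := history A R t ω
  have hkl : kl (empMean h a) (bestEmpMean h) ≤ ENNReal.ofReal K := by
    rw [bestEmpMean_eq_max h hab]
    rcases le_total (empMean h b) (empMean h a) with hle | hle
    · rw [max_eq_left hle, kl_self]
      exact zero_le
    · rw [max_eq_right hle]
      exact kl_le (empMean_nonneg h a) (empMean_le_one h a) hd0 h1.le h2.le
  have h3 := (mul_le_mul_left (le_medWeight hK hkl) 2⁻¹).trans (medWeight_div_two_le h a)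
  have h4 := ENNReal.toReal_mono ((med t h).apply_ne_top a) h3
  rw [ENNReal.toReal_mul, ENNReal.toReal_ofReal (Real.exp_pos _).le, ENNReal.toReal_inv,
    ENNReal.toReal_ofNat] at h4
  refine le_trans ?_ h4
  gcongr
  exact_mod_cast ha t

/-- MED pulls both arms infinitely often. -/
theorem ae_frequently_pull_med [IsProbabilityMeasure P] (hrun : IsRun P μ med A R)
    (hμ : ∀ a, 0 < μ a ∧ μ a < 1) (a : Fin 2) :
    ∀ᵐ ω ∂P, ∃ᶠ t in atTop, A t ω = a := by
  obtain ⟨b, hab⟩ := exists_ne a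
  filter_upwards [hrun.frequently_pull_iff (fun c => ⟨(hμ c).1.le, (hμ c).2.le⟩) a
    (fun _ => Set.univ), hrun.ae_tendsto_empMean hμ b] with ω h1 h2
  simp only [Set.mem_univ, and_true, Set.indicator_univ] at h1
  by_contra hcon
  have hev := not_frequently.1 hcon
  have hB : ∃ᶠ t in atTop, A t ω = b := by
    refine Eventually.frequently (hev.mono fun t ht => ?_)
    omega
  obtain ⟨t₀, ht₀⟩ := eventually_atTop.1 hev
  have hN : ∀ t, visits (history A R t ω) a ≤ visits (history A R t₀ ω) a := by
    intro t
    rcases le_total t t₀ with ht | ht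
    · exact visits_history_mono A R ω a ht
    · induction t, ht using Nat.le_induction with
      | base => exact le_rfl
      | succ t ht ih => rwa [visits_history_succ, if_neg (ht₀ t ht), add_zero]
  obtain ⟨ε, hε, hle⟩ := exists_pos_eventually_le_med hab.symm (hμ b).1 (hμ b).2 (h2 hB) hN
  refine hcon (h1.2 ?_)
  refine (not_summable_iff_tendsto_nat_atTop_of_nonneg fun _ => ENNReal.toReal_nonneg).1 fun hs => ?_
  have := ge_of_tendsto hs.tendsto_atTop_zero hle
  linarith

/-! ### Isolation of the pulls of the worse arm. -/

/-- Just after its pulls, the count of an arm runs through `1, 2, …`, so a sum over pull times is a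
sum over pull numbers. -/
theorem sum_indicator_comp_visits {Ω : Type*} (A : ℕ → Ω → Fin 2) (R : ℕ → Ω → Bool) (ω : Ω)
    (a : Fin 2) (f : ℕ → ℝ) (n : ℕ) :
    ∑ s ∈ Finset.range n, (if A s ω = a then f (visits (history A R (s + 1) ω) a) else 0) =
      ∑ k ∈ Finset.range (visits (history A R n ω) a), f (k + 1) := by
  induction n with
  | zero => simp [visits]
  | succ n ih =>
    rw [Finset.sum_range_succ, ih, visits_history_succ]
    by_cases h : A n ω = a
    · simp [h, Finset.sum_range_succ]
    · simp [h]

/-- Under MED, two pulls of the worse arm at distance `j` happen finitely often. -/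
theorem ae_eventually_not_pull_twice [IsProbabilityMeasure P] (hrun : IsRun P μ med A R)
    (hμ : ∀ a, 0 < μ a ∧ μ a < 1) {a b : Fin 2} (hlt : μ b < μ a) {j : ℕ} (hj : 0 < j) :
    ∀ᵐ ω ∂P, ∀ᶠ s in atTop, ¬(A s ω = b ∧ A (s + j) ω = b) := by
  have hba : b ≠ a := fun h => (h ▸ hlt).false
  -- The pull `j` rounds earlier is visible in the history because `0 < j`.
  let Q : (t : ℕ) → Set (History t) := fun t => {h | ∃ i : Fin t, i + j = t ∧ (h i).1 = b}
  have hQ : ∀ s ω, history A R (s + j) ω ∈ Q (s + j) ↔ A s ω = b := by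
    intro s ω
    constructor
    · rintro ⟨i, hi, h⟩
      have : (i : ℕ) = s := by omega
      rw [← this]
      exact h
    · exact fun h => ⟨⟨s, by omega⟩, rfl, h⟩
  filter_upwards [hrun.frequently_pull_iff (fun c => ⟨(hμ c).1.le, (hμ c).2.le⟩) b Q,
    ae_frequently_pull_med hrun hμ a, ae_frequently_pull_med hrun hμ b,
    hrun.ae_tendsto_empMean hμ a, hrun.ae_tendsto_empMean hμ b] with ω h1 hfa hfb hca hcb
  specialize hca hfa
  specialize hcb hfb
  have hbest : ∀ᶠ t in atTop, empMean (history A R t ω) a = bestEmpMean (history A R t ω) := by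
    filter_upwards [hcb.eventually_lt hca hlt] with t ht
    rw [bestEmpMean_eq_max _ hba, max_eq_right ht.le]
  obtain ⟨c, hc, hcle⟩ := exists_pos_eventually_le_kl (hμ b).1 (hμ b).2 (hμ a).1 (hμ a).2 hlt.ne
    hcb hca
  have hmed : ∀ᶠ t in atTop, (med t (history A R t ω) b).toReal ≤
      Real.exp (-(visits (history A R t ω) b * c)) := by
    filter_upwards [hbest, hcle] with t h2 h3
    rw [h2] at h3
    have h4 := (med_apply_le (a := b) (medWeight_eq_one h2)).trans (medWeight_le hc.le h3)
    have h5 := ENNReal.toReal_mono ENNReal.ofReal_ne_top h4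
    rwa [ENNReal.toReal_ofReal (Real.exp_pos _).le] at h5
  have hsum : Summable fun s => if A s ω = b then
      Real.exp (-(visits (history A R (s + 1) ω) b * c)) else 0 := by
    have hgeo : Summable fun k : ℕ => Real.exp (-(((k + 1 : ℕ) : ℝ) * c)) := by
      have := (summable_nat_add_iff 1).2 (Real.summable_exp_nat_mul_iff.2 (neg_lt_zero.2 hc))
      simpa only [mul_neg] using this
    refine summable_of_sum_range_le (c := ∑' k : ℕ, Real.exp (-(((k + 1 : ℕ) : ℝ) * c)))
      (fun s => by split_ifs <;> positivity) fun n => ?_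
    rw [sum_indicator_comp_visits A R ω b (fun k => Real.exp (-(k * c))) n]
    exact hgeo.sum_le_tsum _ fun _ _ => (Real.exp_pos _).le
  have hsum2 : Summable fun t => (Q t).indicator (fun h => (med t h b).toReal)
      (history A R t ω) := by
    rw [← summable_nat_add_iff j]
    refine Summable.of_norm_bounded_eventually_nat hsum ?_
    filter_upwards [(tendsto_add_atTop_nat j).eventually hmed] with s hs
    by_cases hA : A s ω = b
    · rw [Set.indicator_of_mem ((hQ s ω).2 hA), if_pos hA,
        Real.norm_of_nonneg ENNReal.toReal_nonneg]
      refine hs.trans ?_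
      -- The count at `s + j` already includes the pull in round `s`.
      have := visits_history_mono A R ω b (show s + 1 ≤ s + j by omega)
      gcongr
    · rw [Set.indicator_of_notMem (fun h => hA ((hQ s ω).1 h)), if_neg hA, norm_zero]
  have hnot := not_tendsto_atTop_of_tendsto_nhds hsum2.hasSum.tendsto_sum_nat
  have hev := not_frequently.1 (mt h1.1 hnot)
  filter_upwards [(tendsto_add_atTop_nat j).eventually hev] with s hs h
  exact hs ⟨h.2, (hQ s ω).2 h.1⟩

/-! ### From isolated pulls to the limsup. -/

theorem slidingRegret_eq {Ω : Type*} {A : ℕ → Ω → Fin 2} {ω : Ω} (hlt : μ 1 < μ 0) {T : ℕ} (hT : 1 ≤ T)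
    (hfreq : ∃ᶠ t in atTop, A t ω = 1)
    (hev : ∀ j, 0 < j → ∀ᶠ s in atTop, ¬(A s ω = 1 ∧ A (s + j) ω = 1)) :
    slidingRegret μ A T ω = μ 0 - μ 1 := by
  let n : ℕ → ℕ := fun t => ((Finset.range T).filter fun i => A (t + i) ω = 1).card
  have hn : ∀ t, (T : ℝ) * max (μ 0) (μ 1) - ∑ i ∈ Finset.range T, μ (A (t + i) ω) =
      n t * (μ 0 - μ 1) := by
    intro t
    have h1 : ∀ x : Fin 2, μ x = μ 0 - (if x = 1 then 1 else 0) * (μ 0 - μ 1) := by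
      intro x
      fin_cases x <;> simp
    rw [max_eq_left hlt.le, Finset.sum_congr rfl fun i _ => h1 (A (t + i) ω),
      Finset.sum_sub_distrib, ← Finset.sum_mul]
    simp [n, Finset.sum_boole]
  have hle : ∀ᶠ t in atTop, (n t : ℝ) * (μ 0 - μ 1) ≤ μ 0 - μ 1 := by
    have hall : ∀ᶠ s in atTop, ∀ j ∈ Finset.Ioo 0 T, ¬(A s ω = 1 ∧ A (s + j) ω = 1) :=
      (Finset.eventually_all _).2 fun j hj => hev j (Finset.mem_Ioo.1 hj).1
    obtain ⟨s₀, hs₀⟩ := eventually_atTop.1 hall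
    filter_upwards [eventually_ge_atTop s₀] with t ht
    have hlt2 : ∀ i k, i < k → k < T → A (t + i) ω = 1 → A (t + k) ω = 1 → False := by
      intro i k hik hk h1 h2
      refine hs₀ (t + i) (by omega) (k - i) (Finset.mem_Ioo.2 ⟨by omega, by omega⟩) ⟨h1, ?_⟩
      rwa [show t + i + (k - i) = t + k by omega]
    have hcard : n t ≤ 1 := by
      refine Finset.card_le_one.2 fun i hi k hk => ?_
      simp only [Finset.mem_filter, Finset.mem_range] at hi hk
      rcases lt_trichotomy i k with h | h | h
      · exact (hlt2 i k h hk.1 hi.2 hk.2).elim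
      · exact h
      · exact (hlt2 k i h hi.1 hk.2 hi.2).elim
    have : (n t : ℝ) ≤ 1 := by exact_mod_cast hcard
    nlinarith
  have hge : ∃ᶠ t in atTop, μ 0 - μ 1 ≤ (n t : ℝ) * (μ 0 - μ 1) := by
    refine hfreq.mono fun t ht => ?_
    -- A window that starts at a pull of the worse arm contains it, as `1 ≤ T`.
    have h1 : 0 < n t := Finset.card_pos.2 ⟨0, Finset.mem_filter.2 ⟨Finset.mem_range.2 hT, ht⟩⟩
    have : (1 : ℝ) ≤ n t := by exact_mod_cast h1
    nlinarith
  have hnn : ∀ t, 0 ≤ (n t : ℝ) * (μ 0 - μ 1) :=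
    fun t => mul_nonneg (Nat.cast_nonneg _) (sub_pos.2 hlt).le
  simp only [slidingRegret, hn]
  refine le_antisymm (limsup_le_of_le ?_ hle) (le_limsup_of_frequently_le hge ?_)
  · exact (isBoundedUnder_of ⟨0, hnn⟩ : IsBoundedUnder (· ≥ ·) _ _).isCoboundedUnder_le
  · exact ⟨_, eventually_map.2 hle⟩

end Run

end Bandit

end

theorem mainTheorem3 {Ω : Type*} [MeasurableSpace Ω] (P : Measure Ω) [IsProbabilityMeasure P]
    (μ : Fin 2 → ℝ) (hμ1_pos : 0 < μ 1) (hμ_lt : μ 1 < μ 0) (hμ0_lt_one : μ 0 < 1)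
    (A : ℕ → Ω → Fin 2) (R : ℕ → Ω → Bool) (hrun : Bandit.IsRun P μ Bandit.med A R)
    (T : ℕ) (hT : 1 ≤ T) :
    ∀ᵐ ω ∂P, Bandit.slidingRegret μ A T ω = μ 0 - μ 1 := by
  have hμ : ∀ a, 0 < μ a ∧ μ a < 1 := by
    rw [Fin.forall_fin_two]
    exact ⟨⟨hμ1_pos.trans hμ_lt, hμ0_lt_one⟩, hμ1_pos, hμ_lt.trans hμ0_lt_one⟩
  have hev : ∀ᵐ ω ∂P, ∀ j, 0 < j → ∀ᶠ s in atTop, ¬(A s ω = 1 ∧ A (s + j) ω = 1) :=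
    ae_all_iff.2 fun j => ae_all_iff.2 fun hj =>
      Bandit.ae_eventually_not_pull_twice hrun hμ hμ_lt hj
  filter_upwards [Bandit.ae_frequently_pull_med hrun hμ 1, hev] with ω h1 h2
  exact Bandit.slidingRegret_eq hμ_lt hT h1 h2
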